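/- Let $\mathcal{G}$ be the graph on the vertex set $\{1,\dots,6\}$ with the eight edges $12,14,23,25,36,45,46,56$ (the $2\times 3$ grid with rows $1,2,3$ and $4,5,6$, plus the edge $46$). Its maximal clique size is $q=3$, and its treewidth $\tau(\mathcal{G})=q^*-1$ is $3$, where $q^*$ is the minimum, over all chordal graphs on the same vertex set containing $\mathcal{G}$, of the maximal clique size. **Theorem 5.1.** In the centred Gaussian graphical model on $\mathcal{G}$, that is, the family of all $N(0,\Sigma)$ with $\Sigma$ a positive definite $6\times 6$ matrix such that $(\Sigma^{-1})_{ij}=0$ for all $i\ne j$ with $ij$ not an edge of $\mathcal{G}$, the maximum likelihood estimator exists with probability one already for $n=3$ observations, so that $n$ can equal the treewidth. Precisely: if $X_1,X_2,X_3$ are independent with law $N(0,\Sigma_0)$, where $\Sigma_0$ is any positive definite matrix (in particular, any covariance matrix in the model), then with probability one the likelihood of $X_1,X_2,X_3$ attains its maximum over the covariance matrices in the model. In terms of matrix completion: almost every rank-3 positive semidefinite correlation matrix, restricted to the diagonal and the edges of $\mathcal{G}$, has a positive definite completion. Precisely: for almost every $(u_1,\dots,u_6)\in(S^2)^6$, with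 respect to the product of the surface measures on the unit sphere $S^2\subset\mathbb{R}^3$, the Gram matrix $S=(\langle u_i,u_j\rangle)_{i,j}$ has rank $3$, and there is a positive definite matrix $S'$ with $S'_{ii}=S_{ii}=1$ for all $i$ and $S'_{ij}=S_{ij}$ for every edge $ij$ of $\mathcal{G}$. -/

import Mathlib

open MeasureTheory ProbabilityTheory

noncomputable section

/-- A graph is chordal if every cycle of length greater than 3 has a chord, i.e. an edge of the
graph that joins two vertices of the cycle and is not an edge of the cycle. -/
def SimpleGraph.IsChordalGraph {V : Type*} (G : SimpleGraph V) : Prop :=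
  ∀ (v : V) (c : G.Walk v v), c.IsCycle → 3 < c.length →
    ∃ x ∈ c.support, ∃ y ∈ c.support, G.Adj x y ∧ s(x, y) ∉ c.edges

/-- The minimal value of the maximal clique size over all chordal covers of `G`
(chordal graphs on the same vertex set that contain `G`). -/
def SimpleGraph.minChordalCoverCliqueNum {V : Type*} (G : SimpleGraph V) : ℕ :=
  sInf {k | ∃ H : SimpleGraph V, G ≤ H ∧ H.IsChordalGraph ∧ H.cliqueNum = k}

/-- The treewidth of a graph on a nonempty finite vertex set. -/
def SimpleGraph.chordalTreewidth {V : Type*} (G : SimpleGraph V) : ℕ :=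
  G.minChordalCoverCliqueNum - 1

section GaussianGraphicalModel

variable {V : Type*} [Fintype V] [DecidableEq V]

/-- The covariance matrices of the centred Gaussian graphical model on `G`: positive definite
matrices whose inverse vanishes at all (off-diagonal) nonedges. -/
def ggmCovariances (G : SimpleGraph V) : Set (Matrix V V ℝ) :=
  {S | S.PosDef ∧ ∀ i j, i ≠ j → ¬ G.Adj i j → S⁻¹ i j = 0}

/-- The Lebesgue density of `N(0, S)` at `x`, for a positive definite matrix `S`. -/
def centredGaussianDensity (S : Matrix V V ℝ) (x : EuclideanSpace ℝ V) : ℝ :=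
  (Real.sqrt ((2 * Real.pi) ^ Fintype.card V * S.det))⁻¹ *
    Real.exp (-(x.ofLp ⬝ᵥ S⁻¹.mulVec x.ofLp) / 2)

/-- The likelihood of the covariance matrix `S` given observations `x 0, …, x (n - 1)`. -/
def gaussianLikelihood {n : ℕ} (x : Fin n → EuclideanSpace ℝ V) (S : Matrix V V ℝ) : ℝ :=
  ∏ k, centredGaussianDensity S (x k)

/-- `S` is a maximum likelihood estimate of the covariance matrix, in the Gaussian graphical
model on `G`, for the observations `x`. -/
def IsGGMMaximumLikelihood (G : SimpleGraph V) {n : ℕ} (x : Fin n → EuclideanSpace ℝ V)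
    (S : Matrix V V ℝ) : Prop :=
  S ∈ ggmCovariances G ∧
    ∀ T ∈ ggmCovariances G, gaussianLikelihood x T ≤ gaussianLikelihood x S

/-- The `G`-partial matrix of `M` (its diagonal entries and its entries at the edges of `G`) has
a positive definite completion. -/
def HasPosDefCompletion (G : SimpleGraph V) (M : Matrix V V ℝ) : Prop :=
  ∃ T : Matrix V V ℝ, T.PosDef ∧ (∀ i, T i i = M i i) ∧ ∀ i j, G.Adj i j → T i j = M i j

end GaussianGraphicalModel

/-- The graph with vertices `1, …, 6` and edges `12, 14, 23, 25, 36, 45, 46, 56`;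
the vertex `k` is represented by `k - 1 : Fin 6`. -/
def sixVertexGraph : SimpleGraph (Fin 6) :=
  SimpleGraph.fromEdgeSet
    {s(0, 1), s(0, 3), s(1, 2), s(1, 4), s(2, 5), s(3, 4), s(3, 5), s(4, 5)}

end

/-! A maximum likelihood estimate exists as soon as no nonzero positive semidefinite matrix `K`,
zero at the nonedges, kills all observations. Then the quadratic form summed over the data dominates
a multiple of the trace, so `det K ^ n * exp (-Q K)` attains its maximum at a positive definite `K`
(`exists_isMaxOn_det_pow_mul_exp`); `K⁻¹` is the estimate, and stationarity makes `n • K⁻¹` the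
completion.

For this graph, let `u i` in `ℝ³` collect the `i`-th coordinates of the three observations. Row `i`
of `K` is a linear relation among the `u j` with `j` in the closed neighbourhood of `i`. If any
three of the `u i` are independent, the rows of the degree-two vertices vanish; deleting these
vertices leaves ever smaller neighbourhoods, until `K = 0`
(`eq_zero_of_mem_concentrationCone_sixVertexGraph`). Such general position holds almost surely,
since proper subspaces are null for Gaussian and sphere measures (`ae_linearIndepOn_pi`). -/

namespace SimpleGraph

variable {V : Type*}

/-! ### Chordal covers and the treewidth -/

namespace Walk.IsCycle

variable {G : SimpleGraph V} {v : V} {c : G.Walk v v}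

/-- Removing the first edge leaves a path from `c.snd` to `v`. An edge of a path at its starting
point is its first edge, which would force this path to have length two. -/
theorem snd_penultimate_notMem_edges (hc : c.IsCycle) (hl : 3 < c.length) :
    s(c.snd, c.penultimate) ∉ c.edges := by
  cases c with
  | nil => simp at hl
  | @cons _ w _ h p =>
    have hp := ((Walk.cons_isCycle_iff p h).1 hc).1
    have hl' : 3 ≤ p.length := by simpa using hl
    have hpen : (Walk.cons h p).penultimate = p.getVert (p.length - 1) := by
      rw [Walk.penultimate_cons_of_not_nil _ _ (by rw [Walk.not_nil_iff_lt_length]; lia)]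
    have hinj := hp.getVert_injOn
    have hv : p.getVert (p.length - 1) ≠ v := fun h0 => by
      have := hinj (x₁ := p.length - 1) (x₂ := p.length) (by simp) (by simp)
        (by rw [h0, Walk.getVert_length])
      lia
    rw [hpen, Walk.snd_cons, Walk.edges_cons, List.mem_cons, not_or]
    refine ⟨fun h0 => ?_, fun h0 => ?_⟩
    · rw [Sym2.eq_swap, Sym2.congr_left] at h0
      exact hv h0
    · have h1 := hp.eq_snd_of_mem_edges h0
      have := hinj (x₁ := p.length - 1) (x₂ := 1) (by simp) (by simp; lia) h1
      lia

end Walk.IsCycle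

section SplitGraph

/-- The complete split graph with clique `C`: distinct vertices are adjacent if and only if at
least one of them lies in `C`. -/
def completeSplitGraph (C : Set V) : SimpleGraph V where
  Adj x y := x ≠ y ∧ (x ∈ C ∨ y ∈ C)
  symm := ⟨fun _ _ h => ⟨h.1.symm, h.2.symm⟩⟩
  loopless := ⟨fun _ h => h.1 rfl⟩

variable {C : Finset V}

theorem IsClique.card_le_of_completeSplitGraph {s : Finset V}
    (hs : (completeSplitGraph (C : Set V)).IsClique s) : s.card ≤ C.card + 1 := by
  classical
  have h1 : (s \ C).card ≤ 1 := by
    refine Finset.card_le_one.2 fun a ha b hb => ?_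
    by_contra hab
    rw [Finset.mem_sdiff] at ha hb
    rcases (hs ha.1 hb.1 hab).2 with h | h
    exacts [ha.2 h, hb.2 h]
  have := Finset.card_le_card_sdiff_add_card (s := s) (t := C)
  lia

/-- A cycle of length above three has more vertices than `C`, hence one outside `C`; its two
neighbours on the cycle must lie in `C`, so they span a chord. -/
theorem isChordalGraph_completeSplitGraph (hC : C.card ≤ 3) :
    (completeSplitGraph (C : Set V)).IsChordalGraph := by
  classical
  intro v c hc hl
  obtain ⟨w, hw, hwC⟩ : ∃ w ∈ c.support, w ∉ C := by
    by_contra! h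
    have hnd := hc.support_nodup
    have hsub : c.support.tail.toFinset ⊆ C := fun x hx =>
      h x (List.mem_of_mem_tail (List.mem_toFinset.1 hx))
    have := Finset.card_le_card hsub
    rw [List.toFinset_card_of_nodup hnd, List.length_tail, Walk.length_support] at this
    lia
  set d := c.rotate w hw with hd
  have hdc : d.IsCycle := hc.rotate hw
  have hdl : d.length = c.length := by simp [hd]
  have hdnil : ¬ d.Nil := hdc.not_nil
  have hnot : s(d.snd, d.penultimate) ∉ c.edges := by
    have := hdc.snd_penultimate_notMem_edges (by lia)
    rwa [(c.rotate_edges w hw).perm.mem_iff] at this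
  have h1 : d.snd ∈ C := by
    have := (d.adj_snd hdnil).2
    tauto
  have h2 : d.penultimate ∈ C := by
    have := (d.adj_penultimate hdnil).2
    tauto
  refine ⟨d.snd, ?_, d.penultimate, ?_, ⟨hdc.snd_ne_penultimate, Or.inl h1⟩, hnot⟩
  · exact (Walk.mem_support_rotate_iff _ _ hw).1 (d.getVert_mem_support 1)
  · exact (Walk.mem_support_rotate_iff _ _ hw).1 (d.getVert_mem_support _)

end SplitGraph

namespace IsChordalGraph

variable {G : SimpleGraph V} {a b c d e : V}

theorem adj_or_adj_of_four_cycle (hG : G.IsChordalGraph) (hac : a ≠ c) (hbd : b ≠ d)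
    (hab : G.Adj a b) (hbc : G.Adj b c) (hcd : G.Adj c d) (hda : G.Adj d a) :
    G.Adj a c ∨ G.Adj b d := by
  have h1 := hab.ne; have h2 := hbc.ne; have h3 := hcd.ne; have h4 := hda.ne
  obtain ⟨x, hx, y, hy, hxy, hn⟩ := hG a (.cons hab (.cons hbc (.cons hcd (.cons hda .nil))))
    (by
      rw [Walk.cons_isCycle_iff]
      simp [Walk.cons_isPath_iff]
      grind) (by simp)
  have h5 := hxy.ne
  simp at hx hy hn
  have := G.adj_comm c a
  have := G.adj_comm d b
  grind

theorem adj_of_five_cycle (hG : G.IsChordalGraph) (hac : a ≠ c) (hbd : b ≠ d) (hce : c ≠ e)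
    (hda : d ≠ a) (heb : e ≠ b) (hab : G.Adj a b) (hbc : G.Adj b c) (hcd : G.Adj c d)
    (hde : G.Adj d e) (hea : G.Adj e a) :
    G.Adj a c ∨ G.Adj b d ∨ G.Adj c e ∨ G.Adj d a ∨ G.Adj e b := by
  have h1 := hab.ne; have h2 := hbc.ne; have h3 := hcd.ne; have h4 := hde.ne; have h5 := hea.ne
  obtain ⟨x, hx, y, hy, hxy, hn⟩ :=
    hG a (.cons hab (.cons hbc (.cons hcd (.cons hde (.cons hea .nil)))))
    (by
      rw [Walk.cons_isCycle_iff]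
      simp [Walk.cons_isPath_iff]
      grind) (by simp)
  have h6 := hxy.ne
  simp at hx hy hn
  have := G.adj_comm c a
  have := G.adj_comm d b
  have := G.adj_comm e c
  have := G.adj_comm a d
  have := G.adj_comm b e
  grind

end IsChordalGraph

theorem four_le_cliqueNum [Finite V] {G : SimpleGraph V} {a b c d : V} (hab : G.Adj a b)
    (hac : G.Adj a c) (had : G.Adj a d) (hbc : G.Adj b c) (hbd : G.Adj b d) (hcd : G.Adj c d) :
    4 ≤ G.cliqueNum := by
  classical
  have h : G.IsNClique 4 {a, b, c, d} := by
    rw [isNClique_iff]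
    simp [hab.ne, hac.ne, had.ne, hbc.ne, hbd.ne, hcd.ne, hab, hac, had, hbc, hbd, hcd]
  rw [← h.card_eq]
  exact h.isClique.card_le_cliqueNum

end SimpleGraph

instance : DecidableRel sixVertexGraph.Adj := by
  unfold sixVertexGraph
  infer_instance

theorem cliqueNum_sixVertexGraph : sixVertexGraph.cliqueNum = 3 := by
  apply le_antisymm
  · obtain ⟨s, hs⟩ := sixVertexGraph.exists_isNClique_cliqueNum
    by_contra! h
    obtain ⟨t, ht, htc⟩ := Finset.exists_subset_card_eq (s := s) (n := 4) (by rw [hs.card_eq]; lia)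
    have h4 : sixVertexGraph.IsNClique 4 t := ⟨hs.isClique.subset (by exact_mod_cast ht), htc⟩
    clear ht htc
    revert t
    decide
  · have h : sixVertexGraph.IsNClique 3 {3, 4, 5} :=
      SimpleGraph.is3Clique_iff.2 ⟨3, 4, 5, by decide, by decide, by decide, rfl⟩
    rw [← h.card_eq]
    exact h.isClique.card_le_cliqueNum

/-- Case split on the diagonals 13 and 15. Chords forced in 4-cycles, and in the 5-cycle 0-1-2-5-3
when both diagonals are absent, join some vertex to all of the triangle 345 or make 0, 1, 2, 4 a
clique. -/
theorem four_le_cliqueNum_of_sixVertexGraph_le {H : SimpleGraph (Fin 6)} (hle : sixVertexGraph ≤ H)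
    (hH : H.IsChordalGraph) : 4 ≤ H.cliqueNum := by
  have e01 : H.Adj 0 1 := hle (by decide)
  have e03 : H.Adj 0 3 := hle (by decide)
  have e12 : H.Adj 1 2 := hle (by decide)
  have e14 : H.Adj 1 4 := hle (by decide)
  have e25 : H.Adj 2 5 := hle (by decide)
  have e34 : H.Adj 3 4 := hle (by decide)
  have e35 : H.Adj 3 5 := hle (by decide)
  have e45 : H.Adj 4 5 := hle (by decide)
  have of_2345 (e23 : H.Adj 2 3) (e24 : H.Adj 2 4) : 4 ≤ H.cliqueNum :=
    SimpleGraph.four_le_cliqueNum e23 e24 e25 e34 e35 e45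
  have of_0345 (e04 : H.Adj 0 4) (e05 : H.Adj 0 5) : 4 ≤ H.cliqueNum :=
    SimpleGraph.four_le_cliqueNum e03 e04 e05 e34 e35 e45
  have of_1345 (e13 : H.Adj 1 3) (e15 : H.Adj 1 5) : 4 ≤ H.cliqueNum :=
    SimpleGraph.four_le_cliqueNum e13 e14 e15 e34 e35 e45
  by_cases e13 : H.Adj 1 3
  · by_cases e15 : H.Adj 1 5
    · exact of_1345 e13 e15
    · have e24 := (hH.adj_or_adj_of_four_cycle (by decide) (by decide) e12 e25 e45.symm
        e14.symm).resolve_left e15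
      have e23 := (hH.adj_or_adj_of_four_cycle (by decide) (by decide) e12 e25 e35.symm
        e13.symm).resolve_left e15
      exact of_2345 e23 e24
  · have e04 := (hH.adj_or_adj_of_four_cycle (by decide) (by decide) e01 e14 e34.symm
      e03.symm).resolve_right e13
    by_cases e15 : H.Adj 1 5
    · have e05 := (hH.adj_or_adj_of_four_cycle (by decide) (by decide) e01 e15 e35.symm
        e03.symm).resolve_right e13
      exact of_0345 e04 e05
    · have e24 := (hH.adj_or_adj_of_four_cycle (by decide) (by decide) e12 e25 e45.symm
        e14.symm).resolve_left e15
      rcases hH.adj_of_five_cycle (by decide) (by decide) (by decide) (by decide) (by decide)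
        e01 e12 e25 e35.symm e03.symm with h | h | h | h | h
      · exact SimpleGraph.four_le_cliqueNum e01 h e04 e12 e14 e24
      · exact absurd h e15
      · exact of_2345 h e24
      · exact of_0345 e04 h.symm
      · exact absurd h.symm e13

theorem sixVertexGraph_le_completeSplitGraph :
    sixVertexGraph ≤ SimpleGraph.completeSplitGraph (({1, 3, 5} : Finset (Fin 6)) : Set (Fin 6)) := by
  intro x y
  simp only [SimpleGraph.completeSplitGraph, Finset.mem_coe]
  revert x y
  decide

theorem chordalTreewidth_sixVertexGraph : sixVertexGraph.chordalTreewidth = 3 := by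
  suffices h : sixVertexGraph.minChordalCoverCliqueNum = 4 by
    rw [SimpleGraph.chordalTreewidth, h]
  have hmem : 4 ∈ {k | ∃ H : SimpleGraph (Fin 6), sixVertexGraph ≤ H ∧ H.IsChordalGraph ∧
      H.cliqueNum = k} := by
    have hch := SimpleGraph.isChordalGraph_completeSplitGraph (C := ({1, 3, 5} : Finset (Fin 6)))
      (by decide)
    refine ⟨_, sixVertexGraph_le_completeSplitGraph, hch, le_antisymm ?_
      (four_le_cliqueNum_of_sixVertexGraph_le sixVertexGraph_le_completeSplitGraph hch)⟩
    obtain ⟨s, hs⟩ := SimpleGraph.exists_isNClique_cliqueNum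
      (G := SimpleGraph.completeSplitGraph (({1, 3, 5} : Finset (Fin 6)) : Set (Fin 6)))
    rw [← hs.card_eq]
    exact SimpleGraph.IsClique.card_le_of_completeSplitGraph hs.isClique
  refine le_antisymm (Nat.sInf_le hmem) (le_csInf ⟨4, hmem⟩ ?_)
  rintro k ⟨H, hle, hH, rfl⟩
  exact four_le_cliqueNum_of_sixVertexGraph_le hle hH

/-! ### Compactness and derivatives for positive semidefinite matrices -/

namespace Matrix

variable {V : Type*} [Fintype V]

theorem PosSemidef.abs_apply_le_trace [DecidableEq V] {K : Matrix V V ℝ} (hK : K.PosSemidef) (i j : V) :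
    |K i j| ≤ K.trace := by
  have hd (k : V) : K k k ≤ K.trace :=
    Finset.single_le_sum (f := fun k => K k k) (fun k _ => hK.diag_nonneg) (Finset.mem_univ k)
  have hs : K j i = K i j := by simpa using hK.isHermitian.apply i j
  have h1 := hK.dotProduct_mulVec_nonneg (Pi.single i 1 + Pi.single j 1)
  have h2 := hK.dotProduct_mulVec_nonneg (Pi.single i 1 - Pi.single j 1)
  simp [mulVec_add, mulVec_sub, hs] at h1 h2
  rw [abs_le]
  have := hd i
  have := hd j
  constructor <;> linarith

theorem isClosed_setOf_posSemidef : IsClosed {K : Matrix V V ℝ | K.PosSemidef} := by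
  have : {K : Matrix V V ℝ | K.PosSemidef} =
      {K | Kᴴ = K} ∩ ⋂ x : V → ℝ, {K | 0 ≤ star x ⬝ᵥ (K *ᵥ x)} := by
    ext K
    simp only [Set.mem_ofPred_eq, posSemidef_iff_dotProduct_mulVec, Set.mem_inter_iff,
      Set.mem_iInter]
    rfl
  rw [this]
  refine (isClosed_eq (by fun_prop) continuous_id).inter (isClosed_iInter fun x => ?_)
  exact isClosed_le continuous_const (by fun_prop)

theorem isCompact_setOf_posSemidef_trace_le [DecidableEq V] (R : ℝ) :
    IsCompact {K : Matrix V V ℝ | K.PosSemidef ∧ K.trace ≤ R} := by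
  have hc : IsCompact (Set.univ.pi fun _ : V => Set.univ.pi fun _ : V => Set.Icc (-R) R) :=
    isCompact_univ_pi fun _ => isCompact_univ_pi fun _ => isCompact_Icc
  refine hc.of_isClosed_subset (isClosed_setOf_posSemidef.inter
    (isClosed_le (f := fun K : Matrix V V ℝ => K.trace) (by fun_prop) continuous_const)) ?_
  rintro K ⟨hK, ht⟩ i - j -
  exact abs_le.1 ((hK.abs_apply_le_trace i j).trans ht)

/-- Positivity of the form is an open condition, uniform over the compact unit sphere; scaling gives
all vectors. -/
theorem PosDef.eventually_posDef_add_smul {K E : Matrix V V ℝ} (hK : K.PosDef)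
    (hE : E.IsHermitian) : ∀ᶠ t : ℝ in nhds 0, (K + t • E).PosDef := by
  have hc : Continuous fun p : ℝ × (V → ℝ) => p.2 ⬝ᵥ ((K + p.1 • E) *ᵥ p.2) := by fun_prop
  have h := (isCompact_sphere (0 : V → ℝ) 1).eventually_forall_of_forall_eventually (x₀ := (0 : ℝ))
    (P := fun t x => 0 < x ⬝ᵥ ((K + t • E) *ᵥ x)) fun x hx => by
      refine hc.continuousAt.eventually_const_lt ?_
      have hx0 : x ≠ 0 := by
        rintro rfl
        simp at hx
      simpa using hK.dotProduct_mulVec_pos hx0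
  filter_upwards [h] with t ht
  refine PosDef.of_dotProduct_mulVec_pos (hK.isHermitian.add ?_) fun x hx => ?_
  · rw [IsHermitian, conjTranspose_smul, hE.eq]
    simp
  · have hn : 0 < ‖x‖ := norm_pos_iff.2 hx
    have := ht (‖x‖⁻¹ • x) (by simp [norm_smul, hn.ne'])
    rw [mulVec_smul, smul_dotProduct, dotProduct_smul, smul_eq_mul, smul_eq_mul] at this
    have h2 : 0 < ‖x‖⁻¹ := inv_pos.2 hn
    simpa using (pos_of_mul_pos_right (pos_of_mul_pos_right this h2.le) h2.le)

theorem hasDerivAt_det_add_smul [DecidableEq V] {K : Matrix V V ℝ} (hK : IsUnit K.det) (E : Matrix V V ℝ) :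
    HasDerivAt (fun t : ℝ => (K + t • E).det) (K.det * (K⁻¹ * E).trace) 0 := by
  have h1 (t : ℝ) : (K + t • E).det = K.det * (1 + (K⁻¹ * E).trace * t +
      ((1 + (Polynomial.X : Polynomial ℝ) • (K⁻¹ * E).map Polynomial.C).det.divX.divX).eval t *
        t ^ 2) := by
    rw [← det_one_add_smul, ← det_mul, mul_add, mul_one, mul_smul_comm, ← mul_assoc,
      mul_nonsing_inv _ hK, one_mul]
  simp_rw [h1]
  set p := (1 + (Polynomial.X : Polynomial ℝ) • (K⁻¹ * E).map Polynomial.C).det.divX.divX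
  have h2 := ((((hasDerivAt_id (0 : ℝ)).const_mul (K⁻¹ * E).trace).const_add 1).add
    ((p.hasDerivAt 0).mul (hasDerivAt_pow 2 (0 : ℝ)))).const_mul K.det
  simpa using h2

end Matrix

open scoped Matrix

/-! ### Maximizing over the concentration cone -/

section Concentration

variable {V : Type*}

theorem Matrix.PosSemidef.det_le_trace_pow [Fintype V] [DecidableEq V] {K : Matrix V V ℝ} (hK : K.PosSemidef) :
    K.det ≤ K.trace ^ Fintype.card V := by
  have hd : K.det = ∏ i, hK.isHermitian.eigenvalues i := by
    simpa using hK.isHermitian.det_eq_prod_eigenvalues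
  have ht : K.trace = ∑ i, hK.isHermitian.eigenvalues i := by
    simpa using hK.isHermitian.trace_eq_sum_eigenvalues
  rw [hd, ht, ← Finset.card_univ, ← Finset.prod_const]
  exact Finset.prod_le_prod (fun i _ => hK.eigenvalues_nonneg i) fun i hi =>
    Finset.single_le_sum (fun j _ => hK.eigenvalues_nonneg j) hi

/-- The positive semidefinite matrices that vanish at the off-diagonal nonedges of `G`. -/
def concentrationCone (G : SimpleGraph V) : Set (Matrix V V ℝ) :=
  {K | K.PosSemidef ∧ ∀ i j, i ≠ j → ¬ G.Adj i j → K i j = 0}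

variable {G : SimpleGraph V}

theorem one_mem_concentrationCone [DecidableEq V] : (1 : Matrix V V ℝ) ∈ concentrationCone G :=
  ⟨.one, fun _ _ h _ => Matrix.one_apply_ne h⟩

theorem smul_mem_concentrationCone {K : Matrix V V ℝ} (hK : K ∈ concentrationCone G) {c : ℝ}
    (hc : 0 ≤ c) : c • K ∈ concentrationCone G :=
  ⟨hK.1.smul hc, fun i j h h' => by simp [hK.2 i j h h']⟩

variable [Fintype V] [DecidableEq V]

theorem isCompact_concentrationCone_inter (R : ℝ) :
    IsCompact {K | K ∈ concentrationCone G ∧ K.trace ≤ R} := by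
  refine (Matrix.isCompact_setOf_posSemidef_trace_le (V := V) R).of_isClosed_subset ?_
    fun K hK => ⟨hK.1.1, hK.2⟩
  have hz : IsClosed {K : Matrix V V ℝ | ∀ i j, i ≠ j → ¬ G.Adj i j → K i j = 0} := by
    simp only [Set.ofPred_forall]
    exact isClosed_iInter fun i => isClosed_iInter fun j => isClosed_iInter fun _ =>
      isClosed_iInter fun _ => isClosed_eq (by fun_prop) continuous_const
  exact (Matrix.isClosed_setOf_posSemidef.inter hz).inter
    (isClosed_le (f := fun K : Matrix V V ℝ => K.trace) (by fun_prop) continuous_const)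

variable {Q : Matrix V V ℝ →ₗ[ℝ] ℝ}

/-- `Q` has a positive lower bound on the compact slice of trace one; homogeneity extends it to the
cone. -/
theorem exists_mul_trace_le (hQ : ∀ K ∈ concentrationCone G, 0 ≤ Q K)
    (hQ0 : ∀ K ∈ concentrationCone G, Q K = 0 → K = 0) :
    ∃ c > 0, ∀ K ∈ concentrationCone G, c * K.trace ≤ Q K := by
  have hS : IsCompact ({K | K ∈ concentrationCone G ∧ K.trace ≤ 1} ∩
      {K : Matrix V V ℝ | K.trace = 1}) :=
    (isCompact_concentrationCone_inter 1).inter_right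
      (isClosed_eq (f := fun K : Matrix V V ℝ => K.trace) (by fun_prop) continuous_const)
  have hpos (K : Matrix V V ℝ) (hK : K ∈ ({K | K ∈ concentrationCone G ∧ K.trace ≤ 1} ∩
      {K : Matrix V V ℝ | K.trace = 1})) : 0 < Q K := by
    refine (hQ K hK.1.1).lt_of_ne fun h => ?_
    have h1 : K.trace = 1 := hK.2
    simp [hQ0 K hK.1.1 h.symm] at h1
  obtain ⟨c, hc, hcQ⟩ := hS.exists_forall_le' (f := fun K => Q K)
    Q.continuous_of_finiteDimensional.continuousOn hpos
  refine ⟨c, hc, fun K hK => ?_⟩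
  rcases hK.1.trace_nonneg.eq_or_lt with h | h
  · rw [← h, mul_zero]
    exact hQ K hK
  · have := hcQ (K.trace⁻¹ • K) ⟨⟨smul_mem_concentrationCone hK (inv_nonneg.2 h.le), ?_⟩, ?_⟩
    · rw [map_smul, smul_eq_mul, inv_mul_eq_div, le_div_iff₀ h] at this
      exact this
    · simp [h.ne']
    · simp [h.ne']

theorem exists_isMaxOn_det_pow_mul_exp (hQ : ∀ K ∈ concentrationCone G, 0 ≤ Q K)
    (hQ0 : ∀ K ∈ concentrationCone G, Q K = 0 → K = 0) {n : ℕ} (hn : n ≠ 0) :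
    ∃ K ∈ concentrationCone G, K.PosDef ∧
      IsMaxOn (fun K => K.det ^ n * Real.exp (-Q K)) (concentrationCone G) K := by
  obtain ⟨c, hc, hcQ⟩ := exists_mul_trace_le hQ hQ0
  set f : Matrix V V ℝ → ℝ := fun K => K.det ^ n * Real.exp (-Q K) with hf
  have hf1 : 0 < f 1 := by simp [hf, Real.exp_pos]
  -- This bounds the objective at trace `t`, so beyond some trace every value is below the one at
  -- the identity.
  have hlim : Filter.Tendsto (fun t : ℝ => (t ^ Fintype.card V) ^ n * Real.exp (-(c * t)))
      Filter.atTop (nhds 0) := by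
    have := ((Real.tendsto_pow_mul_exp_neg_atTop_nhds_zero (Fintype.card V * n)).comp
      (Filter.tendsto_id.const_mul_atTop hc)).const_mul ((c ^ (Fintype.card V * n))⁻¹)
    rw [mul_zero] at this
    refine this.congr fun t => ?_
    have : c ^ (Fintype.card V * n) ≠ 0 := by positivity
    simp only [Function.comp_apply, id, mul_pow]
    field_simp
    ring
  obtain ⟨R, hR⟩ := Filter.eventually_atTop.1 (hlim.eventually_lt_const hf1)
  have hcont : Continuous f := by
    have := Q.continuous_of_finiteDimensional
    fun_prop
  obtain ⟨K, hK, hmax⟩ := (isCompact_concentrationCone_inter (G := G)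
    (max R (1 : Matrix V V ℝ).trace)).exists_isMaxOn
      ⟨1, one_mem_concentrationCone, le_max_right _ _⟩ hcont.continuousOn
  have h1K : f 1 ≤ f K := hmax ⟨one_mem_concentrationCone, le_max_right _ _⟩
  refine ⟨K, hK.1, hK.1.1.posDef_iff_isUnit.2 ?_, fun L hL => ?_⟩
  · rw [Matrix.isUnit_iff_isUnit_det, isUnit_iff_ne_zero]
    intro h0
    have : f K = 0 := by simp [hf, h0, hn]
    linarith
  · by_cases hLR : L.trace ≤ max R (1 : Matrix V V ℝ).trace
    · exact hmax ⟨hL, hLR⟩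
    · refine le_trans ?_ ((hR L.trace ((le_max_left _ _).trans (not_le.1 hLR).le)).le.trans h1K)
      have := hL.1.det_nonneg
      have := hL.1.det_le_trace_pow
      have := hcQ L hL
      exact mul_le_mul (by gcongr) (Real.exp_le_exp.2 (by linarith)) (Real.exp_nonneg _)
        (by have := hL.1.trace_nonneg; positivity)

/-- First-order condition: `K + t • E` stays in the cone for small `t` of either sign, so the
derivative at 0 vanishes. -/
theorem natCast_mul_trace_inv_mul_eq {n : ℕ} (hn : n ≠ 0) {K : Matrix V V ℝ}
    (hK : K ∈ concentrationCone G) (hKp : K.PosDef)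
    (hmax : IsMaxOn (fun K => K.det ^ n * Real.exp (-Q K)) (concentrationCone G) K)
    {E : Matrix V V ℝ} (hE : E.IsHermitian) (hEG : ∀ i j, i ≠ j → ¬ G.Adj i j → E i j = 0) :
    n * (K⁻¹ * E).trace = Q E := by
  have hloc : IsLocalMax (fun t : ℝ => (K + t • E).det ^ n * Real.exp (-Q (K + t • E))) 0 := by
    filter_upwards [hKp.eventually_posDef_add_smul hE] with t ht
    have := hmax (show K + t • E ∈ concentrationCone G from
      ⟨ht.posSemidef, fun i j h h' => by simp [hK.2 i j h h', hEG i j h h']⟩)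
    simpa using this
  have hQd : HasDerivAt (fun t : ℝ => -Q (K + t • E)) (-Q E) 0 := by
    simp only [map_add, map_smul, smul_eq_mul]
    have := (((hasDerivAt_id (0 : ℝ)).mul_const (Q E)).const_add (Q K)).neg
    rwa [one_mul] at this
  have hd := ((Matrix.hasDerivAt_det_add_smul hKp.det_pos.ne'.isUnit E).pow n).mul hQd.exp
  have h0 := hloc.hasDerivAt_eq_zero hd
  have hdet := hKp.det_pos
  obtain ⟨m, rfl⟩ := Nat.exists_eq_succ_of_ne_zero hn
  simp only [zero_smul, add_zero, Pi.pow_apply, Nat.succ_eq_add_one, add_tsub_cancel_right] at h0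
  have h1 : K.det ^ (m + 1) * Real.exp (-Q K) * ((m + 1 : ℕ) * (K⁻¹ * E).trace - Q E) = 0 := by
    rw [← h0]
    ring
  have h2 : K.det ^ (m + 1) * Real.exp (-Q K) ≠ 0 := by positivity
  exact sub_eq_zero.1 ((mul_eq_zero.1 h1).resolve_left h2)

end Concentration

/-! ### From the cone to estimates and completions -/

section Likelihood

variable {V : Type*} [Fintype V] {G : SimpleGraph V} {n : ℕ}
  (x : Fin n → EuclideanSpace ℝ V)

/-- The sum of the values of the quadratic form of a matrix at the observations `x`. -/
def quadraticSum : Matrix V V ℝ →ₗ[ℝ] ℝ where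
  toFun K := ∑ k, x k ⬝ᵥ K *ᵥ x k
  map_add' K L := by simp [Matrix.add_mulVec, Finset.sum_add_distrib]
  map_smul' c K := by simp [Matrix.smul_mulVec, Finset.mul_sum]

theorem quadraticSum_apply (K : Matrix V V ℝ) : quadraticSum x K = ∑ k, x k ⬝ᵥ K *ᵥ x k := rfl

theorem quadraticSum_single [DecidableEq V] (i j : V) :
    quadraticSum x (Matrix.single i j 1) = ∑ k, x k i * x k j := by
  rw [quadraticSum_apply]
  refine Finset.sum_congr rfl fun k _ => ?_
  simp [Matrix.single_mulVec, dotProduct, Function.update_apply]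

theorem quadraticSum_nonneg {K : Matrix V V ℝ} (hK : K.PosSemidef) : 0 ≤ quadraticSum x K :=
  Finset.sum_nonneg (s := Finset.univ) fun k _ => hK.dotProduct_mulVec_nonneg (x k : V → ℝ)

theorem mulVec_eq_zero_of_quadraticSum_eq_zero {K : Matrix V V ℝ} (hK : K.PosSemidef)
    (h : quadraticSum x K = 0) (k : Fin n) : K *ᵥ x k = 0 :=
  (hK.dotProduct_mulVec_zero_iff (x k)).1 <| (Finset.sum_eq_zero_iff_of_nonneg (s := Finset.univ) fun k _ =>
    hK.dotProduct_mulVec_nonneg (x k)).1 h k (Finset.mem_univ k)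

variable [DecidableEq V]

theorem gaussianLikelihood_nonneg (S : Matrix V V ℝ) : 0 ≤ gaussianLikelihood x S :=
  Finset.prod_nonneg fun _ _ => mul_nonneg (inv_nonneg.2 (Real.sqrt_nonneg _)) (Real.exp_nonneg _)

/-- Squaring removes the square root and the factor 1/2, leaving a constant times the objective on
the cone. -/
theorem gaussianLikelihood_sq {S : Matrix V V ℝ} (hS : S.PosDef) :
    gaussianLikelihood x S ^ 2 = (((2 * Real.pi) ^ Fintype.card V)⁻¹) ^ n *
      (S⁻¹.det ^ n * Real.exp (-quadraticSum x S⁻¹)) := by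
  have hdet := hS.det_pos
  have h (k : Fin n) : centredGaussianDensity S (x k) ^ 2 =
      ((2 * Real.pi) ^ Fintype.card V)⁻¹ * S⁻¹.det * Real.exp (-(x k ⬝ᵥ S⁻¹ *ᵥ x k)) := by
    rw [centredGaussianDensity, mul_pow, inv_pow, Real.sq_sqrt (by positivity), ← Real.exp_nat_mul,
      mul_inv, Matrix.det_nonsing_inv, Ring.inverse_eq_inv']
    congr 2
    push_cast
    ring
  rw [gaussianLikelihood, ← Finset.prod_pow, Finset.prod_congr rfl fun k _ => h k,
    Finset.prod_mul_distrib, Finset.prod_const, ← Real.exp_sum, Finset.card_univ, Fintype.card_fin,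
    mul_pow, quadraticSum_apply, Finset.sum_neg_distrib, mul_assoc]

theorem inv_mem_concentrationCone {S : Matrix V V ℝ} (hS : S ∈ ggmCovariances G) :
    S⁻¹ ∈ concentrationCone G :=
  ⟨hS.1.inv.posSemidef, hS.2⟩

variable {x}

theorem isGGMMaximumLikelihood_inv {K : Matrix V V ℝ} (hK : K ∈ concentrationCone G)
    (hKp : K.PosDef)
    (hmax : IsMaxOn (fun K => K.det ^ n * Real.exp (-quadraticSum x K)) (concentrationCone G) K) :
    IsGGMMaximumLikelihood G x K⁻¹ := by
  have hinv : K⁻¹⁻¹ = K := Matrix.nonsing_inv_nonsing_inv K hKp.det_pos.ne'.isUnit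
  refine ⟨⟨hKp.inv, by rw [hinv]; exact hK.2⟩, fun T hT => ?_⟩
  rw [← pow_le_pow_iff_left₀ (gaussianLikelihood_nonneg x T) (gaussianLikelihood_nonneg x _)
    two_ne_zero, gaussianLikelihood_sq x hT.1, gaussianLikelihood_sq x hKp.inv, hinv]
  exact mul_le_mul_of_nonneg_left (hmax (inv_mem_concentrationCone hT)) (by positivity)

theorem exists_isGGMMaximumLikelihood (hn : n ≠ 0)
    (hx : ∀ K ∈ concentrationCone G, (∀ k, K *ᵥ x k = 0) → K = 0) :
    ∃ S, IsGGMMaximumLikelihood G x S := by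
  obtain ⟨K, hK, hKp, hmax⟩ := exists_isMaxOn_det_pow_mul_exp (G := G) (Q := quadraticSum x)
    (fun K hK => quadraticSum_nonneg x hK.1)
    (fun K hK h => hx K hK (mulVec_eq_zero_of_quadraticSum_eq_zero x hK.1 h)) hn
  exact ⟨K⁻¹, isGGMMaximumLikelihood_inv hK hKp hmax⟩

/-- Stationarity along the diagonal units and the symmetrized edge units reads off the entries of `n
• K⁻¹`. -/
theorem hasPosDefCompletion_of_concentrationCone (hn : n ≠ 0)
    (hx : ∀ K ∈ concentrationCone G, (∀ k, K *ᵥ x k = 0) → K = 0) :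
    HasPosDefCompletion G (Matrix.of fun i j => ∑ k, x k i * x k j) := by
  obtain ⟨K, hK, hKp, hmax⟩ := exists_isMaxOn_det_pow_mul_exp (G := G) (Q := quadraticSum x)
    (fun K hK => quadraticSum_nonneg x hK.1)
    (fun K hK h => hx K hK (mulVec_eq_zero_of_quadraticSum_eq_zero x hK.1 h)) hn
  have hsymm (i j : V) : K⁻¹ j i = K⁻¹ i j := by simpa using hKp.inv.isHermitian.apply i j
  refine ⟨(n : ℝ) • K⁻¹, hKp.inv.smul (by positivity), fun i => ?_, fun i j hij => ?_⟩
  · have := natCast_mul_trace_inv_mul_eq hn hK hKp hmax (E := Matrix.single i i 1)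
      (by ext a b; simp [Matrix.single_apply, and_comm]) fun a b hab _ =>
        Matrix.single_apply_of_ne _ _ _ _ _ fun h => hab (h.1.symm.trans h.2)
    rw [quadraticSum_single, Matrix.trace_mul_single] at this
    simpa using this
  · have := natCast_mul_trace_inv_mul_eq hn hK hKp hmax
      (E := Matrix.single i j 1 + Matrix.single j i 1)
      (by ext a b; simp [Matrix.single_apply, and_comm, add_comm]) fun a b hab hadj => by
        have h1 : ¬ (i = a ∧ j = b) := by rintro ⟨rfl, rfl⟩; exact hadj hij
        have h2 : ¬ (j = a ∧ i = b) := by rintro ⟨rfl, rfl⟩; exact hadj hij.symm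
        simp [h1, h2]
    rw [map_add, quadraticSum_single, quadraticSum_single, mul_add, Matrix.trace_add,
      Matrix.trace_mul_single, Matrix.trace_mul_single, hsymm i j] at this
    simp only [mul_comm (x _ j)] at this
    simp at this ⊢
    linarith

end Likelihood

/-! ### Almost sure general position -/

section GeneralPosition

theorem MeasureTheory.Measure.ae_pi_of_forall_ae_update {ι : Type*} [Fintype ι] [DecidableEq ι]
    {X : ι → Type*} [∀ i, MeasurableSpace (X i)] {μ : ∀ i, Measure (X i)} [∀ i, SigmaFinite (μ i)]
    {p : (∀ i, X i) → Prop} (hp : MeasurableSet {v | p v}) (a : ι)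
    (h : ∀ᵐ v ∂Measure.pi μ, ∀ᵐ y ∂μ a, p (Function.update v a y)) :
    ∀ᵐ v ∂Measure.pi μ, p v := by
  set f : (∀ i, X i) → ENNReal := {v | ¬ p v}.indicator 1
  have hf : Measurable f := measurable_one.indicator hp.compl
  set g : (∀ i, X i) → ENNReal := fun v => ∫⁻ y, f (Function.update v a y) ∂μ a with hg
  have hgm : Measurable g := by
    have := hf.lmarginal (s := {a}) μ
    rwa [lmarginal_singleton] at this
  -- `g` does not depend on coordinate `a`, so integrating it there multiplies by the mass of `μ a`;
  -- the factor `⊤` absorbs that mass, whatever its size.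
  have hle : ∫⁻ v, f v ∂Measure.pi μ ≤ ∫⁻ v, ⊤ * g v ∂Measure.pi μ := by
    refine lintegral_le_of_lmarginal_le {a} hf (hgm.const_mul _) ?_
    rw [lmarginal_singleton, lmarginal_singleton]
    intro v
    change g v ≤ ∫⁻ y, ⊤ * g (Function.update v a y) ∂μ a
    simp only [hg, Function.update_idem, lintegral_const]
    rcases eq_or_ne (g v) 0 with h0 | h0
    · simp only [hg] at h0
      simp [h0]
    · have hμ : μ a Set.univ ≠ 0 := fun h1 => h0 (by
        simp [hg, Measure.measure_univ_eq_zero.1 h1])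
      simp only [hg] at h0
      rw [ENNReal.top_mul h0, ENNReal.top_mul hμ]
      exact le_top
  have h0 : ∫⁻ v, ⊤ * g v ∂Measure.pi μ = 0 := by
    rw [lintegral_eq_zero_iff (hgm.const_mul _)]
    filter_upwards [h] with v hv
    have : g v = 0 := by
      refine (lintegral_eq_zero_iff (hf.comp (measurable_update v))).2 ?_
      filter_upwards [hv] with y hy
      simp [f, hy]
    simp [this]
  have h1 : ∫⁻ v, f v ∂Measure.pi μ = 0 := le_antisymm (hle.trans h0.le) zero_le
  exact (lintegral_indicator_one hp.compl).symm.trans h1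

/-- Points are added one at a time: fewer than `finrank` vectors span a proper subspace, which the
next one almost surely avoids. -/
theorem ae_linearIndepOn_pi {ι E F : Type*} [Fintype ι] [DecidableEq ι] [MeasurableSpace E]
    [NormedAddCommGroup F] [NormedSpace ℝ F] [FiniteDimensional ℝ F] [MeasurableSpace F]
    [BorelSpace F] {μ : ι → Measure E} [∀ i, SigmaFinite (μ i)] {f : E → F} (hf : Measurable f)
    (hμ : ∀ i, ∀ W : Submodule ℝ F, W ≠ ⊤ → ∀ᵐ e ∂μ i, f e ∉ W) (s : Finset ι)
    (hs : s.card ≤ Module.finrank ℝ F) :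
    ∀ᵐ v ∂Measure.pi μ, LinearIndepOn ℝ (fun i => f (v i)) (s : Set ι) := by
  induction s using Finset.induction_on with
  | empty => simp
  | insert a s ha ih =>
    classical
    rw [Finset.card_insert_of_notMem ha] at hs
    refine Measure.ae_pi_of_forall_ae_update ?_ a ?_
    · have hc : Measurable fun v : ι → E => fun i : (insert a s : Finset ι) => f (v i) :=
        measurable_pi_lambda _ fun i => hf.comp (measurable_pi_apply _)
      exact hc isOpen_setOfPred_linearIndependent.measurableSet
    · filter_upwards [ih (by lia)] with v hv
      have hW : Submodule.span ℝ ((fun i => f (v i)) '' (s : Set ι)) ≠ ⊤ := fun h => by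
        have h1 := finrank_span_finset_le_card (R := ℝ) (s.image fun i => f (v i))
        rw [Finset.coe_image, Set.finrank, h, finrank_top] at h1
        have := Finset.card_image_le (s := s) (f := fun i => f (v i))
        lia
      filter_upwards [hμ a _ hW] with y hy
      have heq : Set.EqOn (fun i => f (v i)) (fun i => f (Function.update v a y i)) s :=
        fun i hi => by
          have : i ≠ a := fun h => ha (h ▸ hi)
          simp [this]
      rw [Finset.coe_insert, linearIndepOn_insert (by simpa using ha)]
      refine ⟨hv.congr heq, ?_⟩
      rw [← heq.image_eq]
      simpa using hy

end GeneralPosition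

section Measures

theorem toSphere_ae_notMem {E : Type*} [NormedAddCommGroup E] [NormedSpace ℝ E]
    [FiniteDimensional ℝ E] [MeasurableSpace E] [BorelSpace E] (μ : Measure E) [μ.IsAddHaarMeasure]
    {W : Submodule ℝ E} (hW : W ≠ ⊤) : ∀ᵐ u : Metric.sphere (0 : E) 1 ∂μ.toSphere, (u : E) ∉ W := by
  have hm : MeasurableSet {u : Metric.sphere (0 : E) 1 | (u : E) ∈ W} :=
    measurable_subtype_coe W.closed_of_finiteDimensional.measurableSet
  rw [ae_iff]
  simp only [not_not]
  rw [Measure.toSphere_apply' μ hm]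
  refine mul_eq_zero_of_right _ (measure_mono_null ?_ (Measure.addHaar_submodule μ W hW))
  rintro _ ⟨c, -, _, ⟨u, hu, rfl⟩, rfl⟩
  exact W.smul_mem c hu

/-- Pairing with a nonzero `z` orthogonal to `W` gives a real Gaussian of positive variance, which
has no atom at 0. -/
theorem multivariateGaussian_ae_notMem {ι : Type*} [Fintype ι] [DecidableEq ι]
    {S : Matrix ι ι ℝ} (hS : S.PosDef) {W : Submodule ℝ (EuclideanSpace ℝ ι)} (hW : W ≠ ⊤) :
    ∀ᵐ x ∂multivariateGaussian 0 S, x ∉ W := by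
  obtain ⟨z, hz, hWz⟩ : ∃ z : EuclideanSpace ℝ ι, z ≠ 0 ∧ ∀ x ∈ W, inner ℝ z x = 0 := by
    have h := mt Submodule.orthogonal_eq_bot_iff.1 hW
    obtain ⟨z, hz, hz0⟩ := Submodule.exists_mem_ne_zero_of_ne_bot h
    exact ⟨z, hz0, fun x hx => Submodule.inner_left_of_mem_orthogonal hx hz⟩
  have hvar : Var[innerSL ℝ z; multivariateGaussian 0 S] = z.ofLp ⬝ᵥ S.mulVec z.ofLp := by
    rw [← covarianceBilin_multivariateGaussian (μ := 0) hS.posSemidef,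
      covarianceBilin_self IsGaussian.memLp_two_id]
    rfl
  have hpos : 0 < z.ofLp ⬝ᵥ S.mulVec z.ofLp := hS.dotProduct_mulVec_pos (by simpa using hz)
  have hmap := IsGaussian.map_eq_gaussianReal (μ := multivariateGaussian 0 S) (innerSL ℝ z)
  have hna := nullSingletonClass_gaussianReal (μ := (multivariateGaussian 0 S)[innerSL ℝ z])
    (v := Var[innerSL ℝ z; multivariateGaussian 0 S].toNNReal) (by
      rw [hvar]; simpa using hpos)
  have h0 := measure_singleton (μ := gaussianReal (multivariateGaussian 0 S)[innerSL ℝ z]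
    Var[innerSL ℝ z; multivariateGaussian 0 S].toNNReal) 0
  rw [← hmap, Measure.map_apply (by fun_prop) (measurableSet_singleton 0)] at h0
  rw [ae_iff]
  refine measure_mono_null (fun x hx => ?_) h0
  exact hWz x (not_not.1 hx)

end Measures

/-! ### Elimination on the six-vertex graph, and the conclusion -/

open scoped Matrix

theorem LinearIndepOn.eq_zero_of_sum_smul_eq_zero {ι R F : Type*} [Fintype ι] [Ring R]
    [AddCommGroup F] [Module R F] {u : ι → F} {s : Finset ι} (hs : LinearIndepOn R u (s : Set ι))
    {c : ι → R} (hc : ∀ i ∉ s, c i = 0) (h : ∑ i, c i • u i = 0) : c = 0 := by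
  rw [← Finset.sum_subset s.subset_univ fun i _ hi => by rw [hc i hi, zero_smul]] at h
  ext i
  by_cases hi : i ∈ s
  · exact linearIndepOn_finset_iff.1 hs c h i hi
  · exact hc i hi

/-- Elimination order: 0 and 2 have closed neighbourhoods of size three; without them 1 meets only
4; then the triangle 345 is left. Symmetry turns each zero row into a zero column. -/
theorem eq_zero_of_mem_concentrationCone_sixVertexGraph {F : Type*} [AddCommGroup F] [Module ℝ F]
    {u : Fin 6 → F}
    (hu : ∀ s : Finset (Fin 6), s.card ≤ 3 → LinearIndepOn ℝ u (s : Set (Fin 6)))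
    {K : Matrix (Fin 6) (Fin 6) ℝ} (hK : K ∈ concentrationCone sixVertexGraph)
    (h : ∀ i, ∑ j, K i j • u j = 0) : K = 0 := by
  have hsymm (i j : Fin 6) : K i j = K j i := by simpa using (hK.1.isHermitian.apply j i)
  have row (s : Finset (Fin 6)) (i : Fin 6) (hs : s.card ≤ 3) (hi : ∀ j ∉ s, K i j = 0) :
      K i = 0 :=
    (hu s hs).eq_zero_of_sum_smul_eq_zero hi (h i)
  have r0 := row {0, 1, 3} 0 (by decide) fun j hj =>
    hK.2 0 j (by revert j; decide) (by revert j; decide)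
  have r2 := row {1, 2, 5} 2 (by decide) fun j hj =>
    hK.2 2 j (by revert j; decide) (by revert j; decide)
  have col0 (i : Fin 6) : K i 0 = 0 := by rw [hsymm, r0, Pi.zero_apply]
  have col2 (i : Fin 6) : K i 2 = 0 := by rw [hsymm, r2, Pi.zero_apply]
  have r1 := row {1, 4} 1 (by decide) fun j hj => by
    by_cases h0 : j = 0
    · rw [h0, col0]
    by_cases h2 : j = 2
    · rw [h2, col2]
    exact hK.2 1 j (by revert j; decide) (by revert j; decide)
  have col1 (i : Fin 6) : K i 1 = 0 := by rw [hsymm, r1, Pi.zero_apply]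
  have r345 (i : Fin 6) : K i = 0 := row {3, 4, 5} i (by decide) fun j hj => by
    have : j = 0 ∨ j = 1 ∨ j = 2 := by revert j; decide
    rcases this with rfl | rfl | rfl
    exacts [col0 i, col1 i, col2 i]
  ext i j
  rw [r345, Pi.zero_apply, Matrix.zero_apply]

theorem eq_zero_of_forall_mulVec_eq_zero {n : ℕ} {x : Fin n → EuclideanSpace ℝ (Fin 6)}
    (hx : ∀ s : Finset (Fin 6), s.card ≤ 3 →
      LinearIndepOn ℝ (fun i (k : Fin n) => x k i) (s : Set (Fin 6))) :
    ∀ K ∈ concentrationCone sixVertexGraph, (∀ k, K *ᵥ x k = 0) → K = 0 := by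
  refine fun K hK h => eq_zero_of_mem_concentrationCone_sixVertexGraph hx hK fun i => ?_
  ext k
  simpa [Matrix.mulVec, dotProduct] using congrFun (h k) i

/-- After enlarging `s` to size `card m` the submatrix is square, so independent rows mean
independent columns. -/
theorem linearIndepOn_coordinates_of_card_le {ι m : Type*} [Fintype ι] [Fintype m]
    [DecidableEq ι] {A : m → ι → ℝ} (hA : ∀ s : Finset ι, s.card = Fintype.card m →
      LinearIndependent ℝ fun k (i : s) => A k i)
    (hcard : Fintype.card m ≤ Fintype.card ι) {s : Finset ι} (hs : s.card ≤ Fintype.card m) :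
    LinearIndepOn ℝ (fun i k => A k i) (s : Set ι) := by
  classical
  obtain ⟨t, hst, ht⟩ := Finset.exists_superset_card_eq hs hcard
  refine LinearIndepOn.mono ?_ (Finset.coe_subset.2 hst)
  have e : m ≃ t := Fintype.equivOfCardEq (by simp [ht])
  have h1 : IsUnit (Matrix.of fun k l => A k (e l)) :=
    Matrix.linearIndependent_rows_iff_isUnit.1
      ((hA t ht).map' (LinearMap.funLeft ℝ ℝ e) (LinearMap.ker_eq_bot.2
        (LinearMap.funLeft_injective_of_surjective ℝ ℝ e e.surjective)))
  have h2 := Matrix.linearIndependent_cols_iff_isUnit.2 h1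
  exact (linearIndependent_equiv e (f := fun (i : t) k => A k i)).1 h2

theorem ae_linearIndepOn_coordinates_multivariateGaussian {ι : Type*} [Fintype ι] [DecidableEq ι]
    {S : Matrix ι ι ℝ} (hS : S.PosDef) {n : ℕ} (hn : n ≤ Fintype.card ι) :
    ∀ᵐ x ∂Measure.pi fun _ : Fin n => multivariateGaussian 0 S, ∀ s : Finset ι, s.card ≤ n →
      LinearIndepOn ℝ (fun i k => x k i) (s : Set ι) := by
  have h : ∀ᵐ x ∂Measure.pi fun _ : Fin n => multivariateGaussian 0 S, ∀ s : Finset ι,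
      s.card = n → LinearIndependent ℝ fun k (i : s) => x k i := by
    simp only [ae_all_iff]
    intro s hs
    let f : EuclideanSpace ℝ ι →ₗ[ℝ] (s → ℝ) :=
      LinearMap.funLeft ℝ ℝ (Subtype.val : s → ι) ∘ₗ
        (WithLp.linearEquiv 2 ℝ (ι → ℝ)).toLinearMap
    have hf : Function.Surjective f :=
      (LinearMap.funLeft_surjective_of_injective ℝ ℝ _ Subtype.val_injective).comp
        (WithLp.linearEquiv 2 ℝ (ι → ℝ)).surjective
    have := ae_linearIndepOn_pi (μ := fun _ : Fin n => multivariateGaussian 0 S) (f := f)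
      f.continuous_of_finiteDimensional.measurable (fun _ W hW =>
        multivariateGaussian_ae_notMem hS (W := W.comap f) (fun h => hW ?_)) Finset.univ
        (by simp [hs])
    · filter_upwards [this] with x hx
      rwa [Finset.coe_univ, linearIndepOn_univ_iff] at hx
    · rw [eq_top_iff, ← Submodule.map_comap_eq_of_surjective hf W, h, Submodule.map_top,
        LinearMap.range_eq_top.2 hf]
  filter_upwards [h] with x hx s hs
  exact linearIndepOn_coordinates_of_card_le (A := fun k i => x k i) (by simpa using hx)
    (by simpa using hn) (by simpa using hs)

theorem rank_gram_eq_finrank {E : Type*} [NormedAddCommGroup E] [InnerProductSpace ℝ E]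
    [FiniteDimensional ℝ E] {ι : Type*} [Fintype ι] {u : ι → E} {s : Finset ι}
    (hs : LinearIndepOn ℝ u (s : Set ι)) (hcard : s.card = Module.finrank ℝ E) :
    (Matrix.gram ℝ u).rank = Module.finrank ℝ E := by
  set b := stdOrthonormalBasis ℝ E
  have hgram := Matrix.gram_eq_conjTranspose_mul (𝕜 := ℝ) b u
  set A : Matrix (Fin (Module.finrank ℝ E)) ι ℝ := Matrix.of fun i j => b.repr (u j) i
  have hA : LinearIndepOn ℝ A.col (s : Set ι) :=
    hs.map_injOn (b.repr.toLinearEquiv.trans (WithLp.linearEquiv 2 ℝ _)).toLinearMap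
      (b.repr.toLinearEquiv.trans (WithLp.linearEquiv 2 ℝ _)).injective.injOn
  have hspan : Submodule.span ℝ (Set.range A.col) = ⊤ := by
    rw [eq_top_iff, ← hA.span_eq_top_of_card_eq_finrank' (by simpa using hcard)]
    exact Submodule.span_mono (Set.range_comp_subset_range _ _)
  rw [hgram, Matrix.rank_conjTranspose_mul_self, Matrix.rank_eq_finrank_span_cols, hspan,
    finrank_top, Module.finrank_fin_fun]

theorem theorem5p1 :
    sixVertexGraph.cliqueNum = 3 ∧
    sixVertexGraph.chordalTreewidth = 3 ∧
    (∀ {Ω : Type*} [MeasurableSpace Ω] (P : Measure Ω) [IsProbabilityMeasure P]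
      (S : Matrix (Fin 6) (Fin 6) ℝ) (_ : S.PosDef)
      (X : Fin 3 → Ω → EuclideanSpace ℝ (Fin 6))
      (_ : ∀ k, HasLaw (X k) (multivariateGaussian 0 S) P) (_ : iIndepFun X P),
      ∀ᵐ ω ∂P, ∃ T, IsGGMMaximumLikelihood sixVertexGraph (fun k => X k ω) T) ∧
    (∀ᵐ u ∂(Measure.pi fun _ : Fin 6 =>
        (volume : Measure (EuclideanSpace ℝ (Fin 3))).toSphere),
      (Matrix.gram ℝ fun i => (u i : EuclideanSpace ℝ (Fin 3))).rank = 3 ∧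
      HasPosDefCompletion sixVertexGraph
        (Matrix.gram ℝ fun i => (u i : EuclideanSpace ℝ (Fin 3)))) := by
  refine ⟨cliqueNum_sixVertexGraph, chordalTreewidth_sixVertexGraph, ?_, ?_⟩
  · intro Ω _ P _ S hS X hX hXi
    have hlaw := hXi.hasLaw_pi hX
    have h := ae_linearIndepOn_coordinates_multivariateGaussian hS (n := 3) (by simp)
    rw [← hlaw.map_eq] at h
    filter_upwards [ae_of_ae_map hlaw.aemeasurable h] with ω hω
    exact exists_isGGMMaximumLikelihood three_ne_zero (eq_zero_of_forall_mulVec_eq_zero hω)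
  · have h : ∀ᵐ u ∂(Measure.pi fun _ : Fin 6 =>
        (volume : Measure (EuclideanSpace ℝ (Fin 3))).toSphere), ∀ s : Finset (Fin 6),
        s.card ≤ 3 → LinearIndepOn ℝ (fun i => (u i : EuclideanSpace ℝ (Fin 3)))
          (s : Set (Fin 6)) := by
      simp only [ae_all_iff]
      intro s hs
      exact ae_linearIndepOn_pi measurable_subtype_coe
        (fun _ W hW => toSphere_ae_notMem volume hW) s (by simpa using hs)
    filter_upwards [h] with u hu
    refine ⟨?_, ?_⟩
    · simpa using rank_gram_eq_finrank (hu {0, 1, 2} (by decide)) (by simp)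
    · have := hasPosDefCompletion_of_concentrationCone (G := sixVertexGraph) three_ne_zero
        -- The three coordinates of the unit vectors serve as observations, so their sum of products
        -- is the Gram matrix.
        (x := fun k => WithLp.toLp 2 fun i => (u i : EuclideanSpace ℝ (Fin 3)) k)
        (eq_zero_of_forall_mulVec_eq_zero fun s hs => (hu s hs).map_injOn
          (WithLp.linearEquiv 2 ℝ (Fin 3 → ℝ)).toLinearMap
          (WithLp.linearEquiv 2 ℝ (Fin 3 → ℝ)).injective.injOn)
      convert this using 1
      ext i j
      simp [Matrix.gram_apply, PiLp.inner_apply, mul_comm]
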